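/- Let $R$ be a profinite ring with unity, not necessarily commutative. An étale space of (right) $R$-modules $(\mathcal A,p,X)$ consists of a profinite space $X$, a topological space $\mathcal A$, a local homeomorphism $p\colon\mathcal A\to X$, and the structure of a right $R$-module on each fibre $A_x=p^{-1}(x)$, such that the zero section $X\to\mathcal A$, the addition $\mathcal A\times_X\mathcal A\to\mathcal A$ and the action $\mathcal A\times R\to\mathcal A$ are continuous (so that each $A_x$ is a discrete $R$-module). A morphism $(\phi,f)\colon(\mathcal A,p,X)\to(\mathcal B,q,Y)$ consists of a continuous map $f\colon Y\to X$ and a continuous map $\phi\colon\mathcal A\times_X Y\to\mathcal B$ that restricts to an $R$-module homomorphism $A_{f(y)}\times\{y\}\to B_y$ for each $y\in Y$. The continuous product $\dot\prod\mathcal A$ is the discrete $R$-module of all global sections of $p$ (continuous maps $s\colon X\to\mathcal A$ with $p\circ s=\mathrm{id}_X$) with pointwise operations; it is a functor, a morphism $(\phi,f)$ sending $s$ to the section $y\mapsto\phi(s(f(y)),y)$. Let $I$ be a non-empty directed set and let $(\mathcal A_i,p_i,X_i)_{i\in I}$, with morphisms $(\phi_{ij},f_{ij})$ from $\mathcal A_i$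 to $\mathcal A_j$ for $i\le j$, be a directed system of étale spaces of $R$-modules. Put $X=\varprojlim X_i$, and let $\varinjlim\mathcal A_i$ be the quotient space of $\bigsqcup_i\mathcal A_i\times_{X_i}X$ in which $(a,x)\in\mathcal A_i\times_{X_i}X$ and $(b,y)\in\mathcal A_j\times_{X_j}X$ are identified if and only if $x=y$ and $\phi_{ik}(a,x_k)=\phi_{jk}(b,x_k)$ for some $k\ge i,j$, where $x_k$ is the image of $x$ in $X_k$; let $p\colon\varinjlim\mathcal A_i\to X$ be the projection. Then: 1. The fibres of $p$ carry $R$-module structures making $(\varinjlim\mathcal A_i,p,X)$ an étale space of $R$-modules such that the projections $X\to X_i$ and the canonical maps $\mathcal A_i\times_{X_i}X\to\varinjlim\mathcal A_i$ form morphisms of étale spaces of $R$-modules, and with these morphisms it is the direct limit (colimit) of the system in the category of étale spaces of $R$-modules. 2. The continuous product commutes with this direct limit: the canonical map $$\varinjlim\dot\prod\mathcal A_i\longrightarrow\dot\prod\varinjlim\mathcal A_i$$ is an isomorphism of discrete $R$-modules. Here the direct limit on the left may be taken in the category of discrete $R$-modules or in that of all $R$-modules. -/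

import Mathlib

open CategoryTheory CategoryTheory.Limits

universe u w

/-- The fibre of a map `p : A → X` over the point `x`. -/
@[ext]
structure EtFibre {A X : Type u} (p : A → X) (x : X) : Type u where
  val : A
  property : p val = x

/-- The structure of an étale space of (right) `R`-modules on a map `p : A → X`: the map `p` is a
local homeomorphism, every fibre of `p` is a right `R`-module (that is, a module over the opposite
ring), and the zero section `o : X → A`, the addition `A ×_X A → A` and the action `A × R → A` are
continuous. (The fibres are then discrete, and `R` acts continuously on them.) -/
structure EtaleModStr (R : Type w) [Ring R] [TopologicalSpace R] {A X : Type u}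
    [TopologicalSpace A] [TopologicalSpace X] (p : A → X) where
  isLocalHomeomorph : IsLocalHomeomorph p
  [addCommGroup : ∀ x : X, AddCommGroup (EtFibre p x)]
  [module : ∀ x : X, Module Rᵐᵒᵖ (EtFibre p x)]
  continuous_zero : Continuous fun x : X => (0 : EtFibre p x).1
  continuous_add : Continuous fun z : {z : A × A // p z.1 = p z.2} =>
    ((⟨z.1.1, z.2⟩ : EtFibre p (p z.1.2)) + ⟨z.1.2, rfl⟩).1
  continuous_smul : Continuous fun z : A × R =>
    (MulOpposite.op z.2 • (⟨z.1, rfl⟩ : EtFibre p (p z.1))).1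

/-- An étale space `(A, p, X)` of (right) `R`-modules over a profinite space `X`. -/
structure EtaleMod (R : Type w) [Ring R] [TopologicalSpace R] where
  base : Profinite.{u}
  total : Type u
  [top : TopologicalSpace total]
  proj : total → base
  str : EtaleModStr R proj

namespace EtaleMod

variable {R : Type w} [Ring R] [TopologicalSpace R]

instance (E : EtaleMod.{u, w} R) : TopologicalSpace E.total := E.top

/-- The fibre `A_x` of an étale space of `R`-modules. -/
abbrev Fibre (E : EtaleMod.{u, w} R) (x : E.base) : Type u := EtFibre E.proj x

instance (E : EtaleMod.{u, w} R) (x : E.base) : AddCommGroup (E.Fibre x) := E.str.addCommGroup x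

instance (E : EtaleMod.{u, w} R) (x : E.base) : Module Rᵐᵒᵖ (E.Fibre x) := E.str.module x

/-- A morphism `(φ, f) : (A, p, X) → (B, q, Y)` of étale spaces of `R`-modules: a continuous map
`f : Y → X` and `R`-linear maps `φ_y : A_{f(y)} → B_y`, for `y ∈ Y`, which together form a
continuous map `φ : A ×_X Y → B`. -/
@[ext]
structure Hom (E F : EtaleMod.{u, w} R) where
  base : C(F.base, E.base)
  fib : ∀ y : F.base, E.Fibre (base y) →ₗ[Rᵐᵒᵖ] F.Fibre y
  continuous_fib : Continuous fun z : {z : E.total × F.base // E.proj z.1 = base z.2} =>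
    (fib z.1.2 ⟨z.1.1, z.2⟩).1

/-- The identity morphism of an étale space of `R`-modules. -/
def Hom.id (E : EtaleMod.{u, w} R) : Hom E E where
  base := ContinuousMap.id _
  fib _ := LinearMap.id
  continuous_fib := continuous_fst.comp continuous_subtype_val

/-- The composite `(ψ, g) ∘ (φ, f)`, whose map of bases is `f ∘ g`. -/
def Hom.comp {E F G : EtaleMod.{u, w} R} (f : Hom E F) (g : Hom F G) : Hom E G where
  base := f.base.comp g.base
  fib z := (g.fib z).comp (f.fib (g.base z))
  continuous_fib := by
    have h1 : Continuous fun z : {z : E.total × G.base // E.proj z.1 = (f.base.comp g.base) z.2} =>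
        (f.fib (g.base z.1.2) ⟨z.1.1, z.2⟩).1 :=
      f.continuous_fib.comp (Continuous.subtype_mk
        (f := fun z : {z : E.total × G.base // E.proj z.1 = (f.base.comp g.base) z.2} =>
          ((z.1.1, g.base z.1.2) : E.total × F.base)) (by fun_prop) fun z => z.2)
    exact g.continuous_fib.comp (Continuous.subtype_mk
      (f := fun z : {z : E.total × G.base // E.proj z.1 = (f.base.comp g.base) z.2} =>
        (((f.fib (g.base z.1.2) ⟨z.1.1, z.2⟩).1, z.1.2) : F.total × G.base))
      (h1.prodMk (by fun_prop)) fun z => (f.fib (g.base z.1.2) ⟨z.1.1, z.2⟩).2)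

/-- The category of étale spaces of `R`-modules. -/
instance : Category.{u} (EtaleMod.{u, w} R) where
  Hom := Hom
  id := Hom.id
  comp := Hom.comp

/-- The continuous product of an étale space of `R`-modules: the `R`-module of its global sections
(continuous maps `s : X → A` with `p ∘ s = id`) with the pointwise operations. -/
def sections (E : EtaleMod.{u, w} R) : Submodule Rᵐᵒᵖ (∀ x : E.base, E.Fibre x) where
  carrier := {s | Continuous fun x => (s x).1}
  zero_mem' := E.str.continuous_zero
  add_mem' {s t} hs ht := by
    have h := E.str.continuous_add.comp (Continuous.subtype_mk
      (f := fun x : E.base => (((s x).1, (t x).1) : E.total × E.total))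
      (Continuous.prodMk hs ht) fun x => (s x).2.trans (t x).2.symm)
    refine h.congr fun x => ?_
    have key : ∀ (y z : E.base) (e : z = y) (a b : E.total) (ha : E.proj a = y)
        (hb : E.proj b = y) (ha' : E.proj a = z) (hb' : E.proj b = z),
        ((⟨a, ha⟩ : E.Fibre y) + ⟨b, hb⟩).1 = ((⟨a, ha'⟩ : E.Fibre z) + ⟨b, hb'⟩).1 := by
      rintro y z rfl a b ha hb ha' hb'
      rfl
    exact key _ _ (t x).2.symm _ _ _ _ _ _
  smul_mem' r s hs := by
    have h := E.str.continuous_smul.comp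
      (Continuous.prodMk (f := fun x : E.base => (s x).1) hs
        (continuous_const (y := MulOpposite.unop r)))
    refine h.congr fun x => ?_
    have key : ∀ (y z : E.base) (e : z = y) (a : E.total) (ha : E.proj a = y)
        (ha' : E.proj a = z),
        (r • (⟨a, ha⟩ : E.Fibre y)).1 = (r • (⟨a, ha'⟩ : E.Fibre z)).1 := by
      rintro y z rfl a ha ha'
      rfl
    exact key _ _ (s x).2.symm _ _ _

/-- The map of continuous products induced by a morphism `(φ, f)`: it sends `s` to the section
`y ↦ φ(s(f(y)), y)`. -/
def sectionsMap {E F : EtaleMod.{u, w} R} (f : E ⟶ F) : E.sections →ₗ[Rᵐᵒᵖ] F.sections where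
  toFun s := ⟨fun y => Hom.fib f y (s.1 (Hom.base f y)), by
    have hs : Continuous fun x => (s.1 x).1 := s.2
    exact (Hom.continuous_fib f).comp (Continuous.subtype_mk
      (f := fun y : F.base => (((s.1 (Hom.base f y)).1, y) : E.total × F.base))
      ((hs.comp (Hom.base f).continuous).prodMk continuous_id)
      fun y => (s.1 (Hom.base f y)).2)⟩
  map_add' s t := by
    apply Subtype.ext
    funext y
    exact map_add (Hom.fib f y) _ _
  map_smul' r s := by
    apply Subtype.ext
    funext y
    exact map_smul (Hom.fib f y) _ _

end EtaleMod

/-- A right `R`-module is discrete if the action `M × R → M` is continuous when `M` has the discrete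
topology. -/
def IsDiscreteModule (R : Type w) [Ring R] [TopologicalSpace R] :
    ObjectProperty (ModuleCat.{u} Rᵐᵒᵖ) := fun M =>
  letI : TopologicalSpace M := ⊥
  Continuous fun z : M × R => MulOpposite.op z.2 • z.1

/-- The category of discrete right `R`-modules. -/
abbrev DMod (R : Type w) [Ring R] [TopologicalSpace R] :=
  (IsDiscreteModule.{u, w} R).FullSubcategory

theorem EtaleMod.sections_isDiscrete {R : Type w} [Ring R] [TopologicalSpace R]
    (E : EtaleMod.{u, w} R) : IsDiscreteModule R (ModuleCat.of Rᵐᵒᵖ E.sections) := by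
  let _ : TopologicalSpace E.sections := ⊥
  have _ : DiscreteTopology E.sections := ⟨rfl⟩
  change Continuous fun z : E.sections × R => MulOpposite.op z.2 • z.1
  rw [continuous_iff_continuousAt]
  rintro ⟨s, r₀⟩
  simp only [ContinuousAt, nhds_prod_eq, nhds_discrete, Filter.tendsto_pure, Filter.pure_prod,
    Filter.eventually_map]
  have hs : Continuous fun x => (s.1 x).1 := s.2
  let act : E.total × R → E.total := fun z =>
    (MulOpposite.op z.2 • (⟨z.1, rfl⟩ : E.Fibre (E.proj z.1))).1
  have hact : Continuous act := E.str.continuous_smul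
  have hp : ∀ z, E.proj (act z) = E.proj z.1 := fun z =>
    (MulOpposite.op z.2 • (⟨z.1, rfl⟩ : E.Fibre (E.proj z.1))).2
  have hV : IsOpen {z : E.base × R | act ((s.1 z.1).1, z.2) = act ((s.1 z.1).1, r₀)} := by
    refine E.str.isLocalHomeomorph.isLocallyInjective.isOpen_eqLocus
      (g₁ := fun z : E.base × R => act ((s.1 z.1).1, z.2))
      (g₂ := fun z : E.base × R => act ((s.1 z.1).1, r₀)) ?_ ?_ ?_
    · exact hact.comp ((hs.comp continuous_fst).prodMk continuous_snd)
    · exact hact.comp ((hs.comp continuous_fst).prodMk continuous_const)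
    · funext z
      simp only [Function.comp, hp]
  have key : ∀ (r : R) (y z : E.base) (e : z = y) (a : E.total) (ha : E.proj a = y)
      (ha' : E.proj a = z), (MulOpposite.op r • (⟨a, ha⟩ : E.Fibre y)).1 =
        (MulOpposite.op r • (⟨a, ha'⟩ : E.Fibre z)).1 := by
    rintro r y z rfl a ha ha'
    rfl
  have hW : ∀ᶠ r in nhds r₀, ∀ x ∈ (Set.univ : Set E.base),
      act ((s.1 x).1, r) = act ((s.1 x).1, r₀) := by
    refine isCompact_univ.eventually_forall_of_forall_eventually fun x _ => ?_
    have : (x, r₀) ∈ {z : E.base × R | act ((s.1 z.1).1, z.2) = act ((s.1 z.1).1, r₀)} := rfl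
    exact (continuous_swap.tendsto (r₀, x)).eventually (hV.mem_nhds this)
  filter_upwards [hW] with r hr
  apply Subtype.ext
  funext x
  apply EtFibre.ext
  refine (key r _ _ (s.1 x).2 _ _ _).trans ((hr x trivial).trans (key r₀ _ _ (s.1 x).2 _ _ _).symm)

/-- The continuous product as a functor from étale spaces of `R`-modules to discrete
`R`-modules. -/
def contProd (R : Type w) [Ring R] [TopologicalSpace R] : EtaleMod.{u, w} R ⥤ DMod.{u, w} R where
  obj E := ⟨ModuleCat.of Rᵐᵒᵖ E.sections, E.sections_isDiscrete⟩
  map f := ObjectProperty.homMk (ModuleCat.ofHom (EtaleMod.sectionsMap f))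

section DirectedSystem

variable {R : Type w} [Ring R] [TopologicalSpace R] {I : Type u} [Preorder I]

/-- The inverse limit of the base spaces `X_i` of a directed system of étale spaces. -/
def BaseLim (F : I ⥤ EtaleMod.{u, w} R) : Type u :=
  {x : ∀ i, (F.obj i).base // ∀ (i j : I) (h : i ≤ j),
    EtaleMod.Hom.base (F.map (homOfLE h)) (x j) = x i}

instance (F : I ⥤ EtaleMod.{u, w} R) : TopologicalSpace (BaseLim F) :=
  instTopologicalSpaceSubtype

theorem BaseLim.isClosed (F : I ⥤ EtaleMod.{u, w} R) :
    IsClosed {x : ∀ i, (F.obj i).base | ∀ (i j : I) (h : i ≤ j),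
      EtaleMod.Hom.base (F.map (homOfLE h)) (x j) = x i} := by
  simp only [Set.ofPred_forall]
  refine isClosed_iInter fun i => isClosed_iInter fun j => isClosed_iInter fun h => ?_
  exact isClosed_eq ((map_continuous _).comp (continuous_apply j)) (continuous_apply i)

instance (F : I ⥤ EtaleMod.{u, w} R) : CompactSpace (BaseLim F) :=
  isCompact_iff_compactSpace.mp (BaseLim.isClosed F).isCompact

instance (F : I ⥤ EtaleMod.{u, w} R) : T2Space (BaseLim F) :=
  inferInstanceAs (T2Space {x : ∀ i, (F.obj i).base // ∀ (i j : I) (h : i ≤ j),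
    EtaleMod.Hom.base (F.map (homOfLE h)) (x j) = x i})

instance (F : I ⥤ EtaleMod.{u, w} R) : TotallyDisconnectedSpace (BaseLim F) :=
  inferInstanceAs (TotallyDisconnectedSpace {x : ∀ i, (F.obj i).base // ∀ (i j : I) (h : i ≤ j),
    EtaleMod.Hom.base (F.map (homOfLE h)) (x j) = x i})

/-- The projection of the inverse limit onto `X_i`. -/
def BaseLim.π (F : I ⥤ EtaleMod.{u, w} R) (i : I) : C(BaseLim F, (F.obj i).base) :=
  ⟨fun x => x.1 i, (continuous_apply i).comp continuous_subtype_val⟩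

/-- The disjoint union over all `i` of the pullbacks `A_i ×_{X_i} X`, where `X` is the inverse limit
of the `X_i`. -/
abbrev PreTotal (F : I ⥤ EtaleMod.{u, w} R) : Type u :=
  Σ i : I, {z : (F.obj i).total × BaseLim F // (F.obj i).proj z.1 = BaseLim.π F i z.2}

/-- For `i ≤ k` and a point `(a, x)` of `A_i ×_{X_i} X`, the image `φ_{ik}(a, x_k)` of `a`
in `A_k`. -/
def PreTotal.push {F : I ⥤ EtaleMod.{u, w} R} (z : PreTotal F) (k : I) (h : z.1 ≤ k) :
    (F.obj k).total :=
  (EtaleMod.Hom.fib (F.map (homOfLE h)) (BaseLim.π F k z.2.1.2)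
    ⟨z.2.1.1, z.2.2.trans (z.2.1.2.2 _ _ h).symm⟩).1

theorem PreTotal.push_push {F : I ⥤ EtaleMod.{u, w} R} (z z' : PreTotal F) (k l : I)
    (h : z.1 ≤ k) (h' : z'.1 ≤ k) (hl : k ≤ l) (hx : z.2.1.2 = z'.2.1.2)
    (e : z.push k h = z'.push k h') : z.push l (h.trans hl) = z'.push l (h'.trans hl) := by
  have key : ∀ (y : PreTotal F) (hy : y.1 ≤ k) (b : (F.obj k).total) (x : BaseLim F)
      (hb : (F.obj k).proj b = EtaleMod.Hom.base (F.map (homOfLE hl)) (BaseLim.π F l x)),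
      y.2.1.2 = x → y.push k hy = b → y.push l (hy.trans hl) =
        (EtaleMod.Hom.fib (F.map (homOfLE hl)) (BaseLim.π F l x) ⟨b, hb⟩).1 := by
    rintro ⟨i, ⟨⟨a, x⟩, ha⟩⟩ hy b _ hb rfl rfl
    have gen : ∀ (g g' : F.obj i ⟶ F.obj l) (_ : g = g') (t : (F.obj l).base)
        (p₁ : (F.obj i).proj a = EtaleMod.Hom.base g t)
        (p₂ : (F.obj i).proj a = EtaleMod.Hom.base g' t),
        (EtaleMod.Hom.fib g t ⟨a, p₁⟩).1 = (EtaleMod.Hom.fib g' t ⟨a, p₂⟩).1 := by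
      rintro g _ rfl t p₁ p₂
      rfl
    have ec : F.map (homOfLE (hy.trans hl)) = F.map (homOfLE hy) ≫ F.map (homOfLE hl) := by
      rw [← F.map_comp]
      rfl
    refine (gen _ _ ec (BaseLim.π F l x) (ha.trans (x.2 _ _ (hy.trans hl)).symm) ?_).trans ?_
    · exact (ha.trans (x.2 _ _ (hy.trans hl)).symm).trans (by rw [ec]; rfl)
    · have gen2 : ∀ (t t' : (F.obj k).base) (_ : t = t')
          (p₁ : (F.obj i).proj a = EtaleMod.Hom.base (F.map (homOfLE hy)) t)
          (p₂ : (F.obj i).proj a = EtaleMod.Hom.base (F.map (homOfLE hy)) t')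
          (q₁ : (F.obj k).proj (EtaleMod.Hom.fib (F.map (homOfLE hy)) t ⟨a, p₁⟩).1 =
            EtaleMod.Hom.base (F.map (homOfLE hl)) (BaseLim.π F l x))
          (q₂ : (F.obj k).proj (EtaleMod.Hom.fib (F.map (homOfLE hy)) t' ⟨a, p₂⟩).1 =
            EtaleMod.Hom.base (F.map (homOfLE hl)) (BaseLim.π F l x)),
          (EtaleMod.Hom.fib (F.map (homOfLE hl)) (BaseLim.π F l x) ⟨_, q₁⟩).1 =
            (EtaleMod.Hom.fib (F.map (homOfLE hl)) (BaseLim.π F l x) ⟨_, q₂⟩).1 := by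
        rintro t _ rfl p₁ p₂ q₁ q₂
        rfl
      exact gen2 _ _ (x.2 _ _ hl) _ _ (EtaleMod.Hom.fib (F.map (homOfLE hy)) _ _).2 _
  have hb : (F.obj k).proj (z.push k h) =
      EtaleMod.Hom.base (F.map (homOfLE hl)) (BaseLim.π F l z.2.1.2) :=
    (EtaleMod.Hom.fib (F.map (homOfLE h)) _ _).2.trans (z.2.1.2.2 _ _ hl).symm
  rw [key z h _ z.2.1.2 hb rfl rfl, key z' h' _ z.2.1.2 hb hx.symm e.symm]

/-- Two points of the disjoint union are identified when they lie over the same point of the inverse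
limit and become equal at some later stage. -/
instance PreTotal.setoid [IsDirectedOrder I] (F : I ⥤ EtaleMod.{u, w} R) :
    Setoid (PreTotal F) where
  r z z' := z.2.1.2 = z'.2.1.2 ∧ ∃ (k : I) (h : z.1 ≤ k) (h' : z'.1 ≤ k),
    z.push k h = z'.push k h'
  iseqv := by
    refine ⟨fun z => ⟨rfl, z.1, le_rfl, le_rfl, rfl⟩, ?_, ?_⟩
    · rintro z z' ⟨hx, k, h, h', e⟩
      exact ⟨hx.symm, k, h', h, e.symm⟩
    · rintro z z' z'' ⟨hx, k, h, h', e⟩ ⟨hx', l, g, g', e'⟩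
      obtain ⟨m, hk, hl⟩ := exists_ge_ge k l
      exact ⟨hx.trans hx', m, h.trans hk, g'.trans hl,
        (PreTotal.push_push z z' k m h h' hk hx e).trans
          (PreTotal.push_push z' z'' l m g g' hl hx' e')⟩

variable [IsDirectedOrder I]

/-- The total space of the direct limit: the direct limit of the spaces `A_i ×_{X_i} X` with the
direct limit (quotient) topology. Its fibre over `x = (x_i)` is the direct limit of the fibres
of `A_i` over `x_i`. -/
def TotalLim (F : I ⥤ EtaleMod.{u, w} R) : Type u := Quotient (PreTotal.setoid F)

instance (F : I ⥤ EtaleMod.{u, w} R) : TopologicalSpace (TotalLim F) :=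
  inferInstanceAs (TopologicalSpace (Quotient (PreTotal.setoid F)))

/-- The projection of the direct limit of the `A_i` to the inverse limit of the `X_i`. -/
def TotalLim.proj (F : I ⥤ EtaleMod.{u, w} R) : TotalLim F → BaseLim F :=
  Quotient.lift (fun z => z.2.1.2) fun _ _ h => h.1

/-- The canonical map `A_i ×_{X_i} X → lim A_j`, on the fibre over `x`. -/
def TotalLim.mk (F : I ⥤ EtaleMod.{u, w} R) (i : I) (x : BaseLim F)
    (a : (F.obj i).Fibre (BaseLim.π F i x)) : TotalLim F :=
  Quotient.mk (PreTotal.setoid F) ⟨i, ⟨(a.1, x), a.2⟩⟩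

/-- The direct limit as an étale space of `R`-modules, given the structure of one on its
projection. -/
def directLimit (F : I ⥤ EtaleMod.{u, w} R) (S : EtaleModStr R (TotalLim.proj F)) :
    EtaleMod.{u, w} R where
  base := Profinite.of (BaseLim F)
  total := TotalLim F
  proj := TotalLim.proj F
  str := S

end DirectedSystem

/-! Over `X`, each pullback `A_i ×_{X_i} X` is a local homeomorphism, so the transition maps between
pullbacks, being continuous maps over `X`, are open. Hence the quotient map onto `TotalLim F` is
open (`isOpenQuotientMap_preTotal`), and both `p` and the maps from the stages to the limit are
local homeomorphisms. Continuous maps into the limit therefore lift locally to one stage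
(`exists_local_lift`). Each fibre is the algebraic direct limit of the stage fibres, and local lifts
transfer continuity of its operations, and of the maps out of it given by cocones, from the stages.

For sections the tool is compactness. A section of the limit agrees near each point with the image
of a section of some stage, on a set pulled back from a clopen set of a stage; finitely many such
sets cover `X`, and the pieces glue at a common stage (`exists_sectionsMap_toDirectLimit_eq`). A
stage section that dies in the limit vanishes, at one later stage `k`, on the image of `X`. Its zero
locus in `X_k` is open, so it contains the image of a whole `X_l` (`BaseLim.exists_base_mem`), and
the section is zero at stage `l` (`exists_sectionsMap_map_eq_zero`). -/

open Topology

/-! ### Local homeomorphisms: base change and descent. -/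

/-- The projection of a fibre product to its second factor is a local homeomorphism if the first
map is one. -/
theorem IsLocalHomeomorph.fibreProduct_snd {A X Y : Type*} [TopologicalSpace A]
    [TopologicalSpace X] [TopologicalSpace Y] {p : A → X} (hp : IsLocalHomeomorph p) {f : Y → X}
    (hf : Continuous f) :
    IsLocalHomeomorph fun z : {z : A × Y // p z.1 = f z.2} => z.1.2 := by
  refine isLocalHomeomorph_iff_isOpenEmbedding_restrict.2 fun z => ?_
  obtain ⟨e, he, rfl⟩ := hp z.1.1
  let o : Set {z : A × Y // e z.1 = f z.2} := {z | z.1.1 ∈ e.source}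
  have ho : IsOpen o := e.open_source.preimage (continuous_fst.comp continuous_subtype_val)
  have hoe : IsOpenEmbedding (o.domRestrict fun z : {z : A × Y // e z.1 = f z.2} => z.1.2) := by
    have hc : Continuous (o.domRestrict fun z : {z : A × Y // e z.1 = f z.2} => z.1.2) := by
      unfold Set.domRestrict
      fun_prop
    let V : Set Y := f ⁻¹' e.target
    have hV : IsOpen V := e.open_target.preimage hf
    have key : ∀ y : V, e (e.symm (f y)) = f y := fun y => e.right_inv y.2
    -- A local inverse of the first map, evaluated along `f`, gives the inverse of the projection
    -- over `V`.
    let g : V → o := fun y => ⟨⟨(e.symm (f y), y), key y⟩, e.map_target y.2⟩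
    have hg : Continuous g := by
      refine Continuous.subtype_mk (Continuous.subtype_mk (Continuous.prodMk ?_
        continuous_subtype_val) _) _
      exact e.continuousOn_symm.comp_continuous (hf.comp continuous_subtype_val) fun y => y.2
    have hmem : ∀ z : o, z.1.1.2 ∈ V := fun z => by
      change f z.1.1.2 ∈ e.target
      rw [← z.1.2]
      exact e.map_source z.2
    let h : o ≃ₜ V :=
      { toFun := fun z => ⟨z.1.1.2, hmem z⟩
        invFun := g
        left_inv := fun z => by
          refine Subtype.ext (Subtype.ext (Prod.ext ?_ rfl))
          change e.symm (f z.1.1.2) = z.1.1.1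
          rw [← z.1.2]
          exact e.left_inv z.2
        right_inv := fun y => rfl
        continuous_toFun := hc.subtype_mk _
        continuous_invFun := hg }
    exact hV.isOpenEmbedding_subtypeVal.comp h.isOpenEmbedding
  exact ⟨o, ho.mem_nhds he, hoe⟩

/-- A map `p` is a local homeomorphism if its composite with a continuous open surjection is. -/
theorem IsLocalHomeomorph.of_comp_isOpenQuotientMap {A B X : Type*} [TopologicalSpace A]
    [TopologicalSpace B] [TopologicalSpace X] {q : A → B} {p : B → X}
    (hq : IsOpenQuotientMap q) (h : IsLocalHomeomorph (p ∘ q)) : IsLocalHomeomorph p := by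
  rw [isLocalHomeomorph_iff_isOpenEmbedding_restrict] at h ⊢
  intro b
  obtain ⟨a, rfl⟩ := hq.surjective b
  obtain ⟨U, hU, hoe⟩ := h a
  have hpc : Continuous p := by
    refine hq.isQuotientMap.continuous_iff.2 ?_
    exact (isLocalHomeomorph_iff_isOpenEmbedding_restrict.2 h).continuous
  have hpo : IsOpenMap p := fun W hW => by
    have := (isLocalHomeomorph_iff_isOpenEmbedding_restrict.2 h).isOpenMap _
      (hW.preimage hq.continuous)
    rwa [Set.image_comp, Set.image_preimage_eq _ hq.surjective] at this
  -- This image is open because `q` is, and `p` is injective on it because `p ∘ q` is injective on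
  -- `U`.
  refine ⟨q '' interior U, (hq.isOpenMap _ isOpen_interior).mem_nhds
    ⟨a, mem_interior_iff_mem_nhds.2 hU, rfl⟩, ?_⟩
  refine IsOpenEmbedding.of_continuous_injective_isOpenMap
    (hpc.comp continuous_subtype_val) ?_
    (hpo.domRestrict (hq.isOpenMap _ isOpen_interior))
  rintro ⟨_, y, hy, rfl⟩ ⟨_, z, hz, rfl⟩ e
  have : (⟨y, interior_subset hy⟩ : U) = ⟨z, interior_subset hz⟩ := hoe.injective e
  obtain rfl := congrArg Subtype.val this
  rfl

/-! ### Comparing fibres and morphisms through the total space. -/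

namespace EtaleMod

variable {R : Type w} [Ring R] [TopologicalSpace R]

/-- The identification of the fibres over two equal points. -/
def fibreCast (E : EtaleMod.{u, w} R) {x y : E.base} (h : x = y) :
    E.Fibre x →ₗ[Rᵐᵒᵖ] E.Fibre y where
  toFun a := ⟨a.1, a.2.trans h⟩
  map_add' a b := by subst h; rfl
  map_smul' r a := by subst h; rfl

/-- Fibres over equal points are different types, so elements are compared by their underlying
points; this avoids transports. -/
theorem Hom.fib_congr {E F : EtaleMod.{u, w} R} {f g : E ⟶ F} (h : f = g) {y z : F.base}
    (hyz : y = z) {a : E.Fibre (Hom.base f y)} {b : E.Fibre (Hom.base g z)} (hab : a.1 = b.1) :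
    (Hom.fib f y a).1 = (Hom.fib g z b).1 := by
  subst h hyz
  rw [EtFibre.ext hab]

theorem Hom.ext_val {E F : EtaleMod.{u, w} R} {f g : E ⟶ F}
    (hb : ∀ y, Hom.base f y = Hom.base g y)
    (h : ∀ y (a : E.Fibre (Hom.base f y)) (b : E.Fibre (Hom.base g y)), a.1 = b.1 →
      (Hom.fib f y a).1 = (Hom.fib g y b).1) : f = g := by
  obtain ⟨fb, ff, _⟩ := f
  obtain ⟨gb, gf, _⟩ := g
  obtain rfl : fb = gb := ContinuousMap.ext hb
  obtain rfl : ff = gf := funext fun y => LinearMap.ext fun a => EtFibre.ext (h y a a rfl)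
  rfl

end EtaleMod

open EtaleMod

/-! ### Topology and fibres of the direct limit. -/

section DirectedSystem

variable {R : Type w} [Ring R] [TopologicalSpace R] {I : Type u} [Preorder I]

/-- The pullback `A_i ×_{X_i} X`. -/
abbrev StagePullback (F : I ⥤ EtaleMod.{u, w} R) (i : I) : Type u :=
  {z : (F.obj i).total × BaseLim F // (F.obj i).proj z.1 = BaseLim.π F i z.2}

theorem StagePullback.isLocalHomeomorph (F : I ⥤ EtaleMod.{u, w} R) (i : I) :
    IsLocalHomeomorph fun z : StagePullback F i => z.1.2 :=
  (F.obj i).str.isLocalHomeomorph.fibreProduct_snd (map_continuous (BaseLim.π F i))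

/-- The map `φ_{ij}` on the fibres over a point of the inverse limit. -/
def fibreTransition (F : I ⥤ EtaleMod.{u, w} R) (x : BaseLim F) (i j : I) (h : i ≤ j) :
    (F.obj i).Fibre (BaseLim.π F i x) →ₗ[Rᵐᵒᵖ] (F.obj j).Fibre (BaseLim.π F j x) :=
  (Hom.fib (F.map (homOfLE h)) (BaseLim.π F j x)).comp
    ((F.obj i).fibreCast (x.2 i j h).symm)

instance (F : I ⥤ EtaleMod.{u, w} R) (x : BaseLim F) :
    DirectedSystem (fun i => (F.obj i).Fibre (BaseLim.π F i x))
      (fun i j h => fibreTransition F x i j h) where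
  map_self i a := by
    have e : F.map (homOfLE (le_refl i)) = 𝟙 (F.obj i) := F.map_id i
    exact EtFibre.ext (Hom.fib_congr (b := a) e rfl rfl)
  map_map k j i h h' a := by
    have e : F.map (homOfLE (h.trans h')) = F.map (homOfLE h) ≫ F.map (homOfLE h') := by
      rw [← F.map_comp]
      rfl
    have hb : (F.obj i).proj a.1 =
        Hom.base (F.map (homOfLE h) ≫ F.map (homOfLE h')) (BaseLim.π F k x) := by
      rw [← e]
      exact a.2.trans (x.2 _ _ _).symm
    refine EtFibre.ext (Eq.trans ?_ (Hom.fib_congr (a := ⟨a.1, hb⟩) e.symm rfl rfl))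
    exact Hom.fib_congr rfl rfl (Hom.fib_congr rfl (x.2 _ _ _).symm rfl)

/-- The map `A_i ×_{X_i} X → A_j ×_{X_j} X` for `i ≤ j`. -/
def stageTransition (F : I ⥤ EtaleMod.{u, w} R) (i j : I) (h : i ≤ j) (z : StagePullback F i) :
    StagePullback F j :=
  ⟨((fibreTransition F z.1.2 i j h ⟨z.1.1, z.2⟩).1, z.1.2),
    (fibreTransition F z.1.2 i j h ⟨z.1.1, z.2⟩).2⟩

theorem stageTransition.continuous (F : I ⥤ EtaleMod.{u, w} R) (i j : I) (h : i ≤ j) :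
    Continuous (stageTransition F i j h) := by
  refine Continuous.subtype_mk (Continuous.prodMk ?_ (by fun_prop)) _
  exact (Hom.continuous_fib (F.map (homOfLE h))).comp (Continuous.subtype_mk
    (f := fun z : StagePullback F i => (z.1.1, BaseLim.π F j z.1.2))
    (by fun_prop) fun z => z.2.trans (z.1.2.2 i j h).symm)

/-- A continuous map over `X` between two local homeomorphisms to `X` is itself a local
homeomorphism. -/
theorem stageTransition.isOpenMap (F : I ⥤ EtaleMod.{u, w} R) (i j : I) (h : i ≤ j) :
    IsOpenMap (stageTransition F i j h) :=
  (IsLocalHomeomorph.of_comp (g := fun z : StagePullback F j => z.1.2)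
    (StagePullback.isLocalHomeomorph F i) (StagePullback.isLocalHomeomorph F j)
    (stageTransition.continuous F i j h)).isOpenMap

variable [IsDirectedOrder I]

/-- The canonical map `A_i ×_{X_i} X → lim A_j`. -/
def stageMk (F : I ⥤ EtaleMod.{u, w} R) (i : I) (z : StagePullback F i) : TotalLim F :=
  TotalLim.mk F i z.1.2 ⟨z.1.1, z.2⟩

theorem stageMk.continuous (F : I ⥤ EtaleMod.{u, w} R) (i : I) : Continuous (stageMk F i) :=
  continuous_quotient_mk'.comp (continuous_sigmaMk (σ := StagePullback F))

theorem stageMk_eq_iff (F : I ⥤ EtaleMod.{u, w} R) {i j : I} (z : StagePullback F i)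
    (z' : StagePullback F j) : stageMk F i z = stageMk F j z' ↔
      ∃ (k : I) (h : i ≤ k) (h' : j ≤ k), stageTransition F i k h z = stageTransition F j k h' z' := by
  refine Quotient.eq.trans ⟨?_, ?_⟩
  · rintro ⟨hx, k, h, h', e⟩
    exact ⟨k, h, h', Subtype.ext (Prod.ext e hx)⟩
  · rintro ⟨k, h, h', e⟩
    exact ⟨congrArg (fun z => z.1.2) e, k, h, h', congrArg (fun z => z.1.1) e⟩

/-- At stage `j`, the saturation of `W` is a union of sets got by pushing a part of `W` to a later
stage `k` and pulling back; transitions are open and continuous. -/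
theorem isOpenQuotientMap_preTotal (F : I ⥤ EtaleMod.{u, w} R) :
    IsOpenQuotientMap (Quotient.mk (PreTotal.setoid F)) := by
  refine ⟨Quotient.mk_surjective, continuous_quotient_mk', fun W hW => ?_⟩
  refine isOpen_coinduced.2 (isOpen_sigma_iff.2 fun j => ?_)
  have : Sigma.mk j ⁻¹' (Quotient.mk (PreTotal.setoid F) ⁻¹'
      (Quotient.mk (PreTotal.setoid F) '' W)) =
      ⋃ (i : I) (k : I) (h : i ≤ k) (h' : j ≤ k),
        stageTransition F j k h' ⁻¹' (stageTransition F i k h '' (Sigma.mk i ⁻¹' W)) := by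
    ext z
    simp only [Set.mem_preimage, Set.mem_image, Set.mem_iUnion]
    constructor
    · rintro ⟨⟨i, y⟩, hy, e⟩
      obtain ⟨k, h, h', e⟩ := (stageMk_eq_iff F y z).1 e
      exact ⟨i, k, h, h', y, hy, e⟩
    · rintro ⟨i, k, h, h', y, hy, e⟩
      exact ⟨⟨i, y⟩, hy, (stageMk_eq_iff F y z).2 ⟨k, h, h', e⟩⟩
  refine (congrArg IsOpen this).mpr ?_
  refine isOpen_iUnion fun i => isOpen_iUnion fun k => isOpen_iUnion fun h => isOpen_iUnion fun h' =>
    (stageTransition.isOpenMap F i k h _ ?_).preimage (stageTransition.continuous F j k h')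
  exact isOpen_sigma_iff.1 hW i

/-- It suffices to treat the composite with the open quotient map, which on each summand is the
projection of a pullback. -/
theorem TotalLim.isLocalHomeomorph_proj (F : I ⥤ EtaleMod.{u, w} R) :
    IsLocalHomeomorph (TotalLim.proj F) := by
  refine IsLocalHomeomorph.of_comp_isOpenQuotientMap (isOpenQuotientMap_preTotal F) ?_
  rw [isLocalHomeomorph_iff_isOpenEmbedding_restrict]
  rintro ⟨i, z⟩
  obtain ⟨U, hU, hoe⟩ :=
    isLocalHomeomorph_iff_isOpenEmbedding_restrict.1 (StagePullback.isLocalHomeomorph F i) z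
  obtain ⟨V, hVU, hV, hz⟩ := mem_nhds_iff.1 hU
  refine ⟨Sigma.mk i '' V, (isOpenMap_sigmaMk (σ := StagePullback F) _ hV).mem_nhds ⟨z, hz, rfl⟩, ?_⟩
  have hcont : Continuous (TotalLim.proj F ∘ Quotient.mk (PreTotal.setoid F)) :=
    continuous_sigma fun j => continuous_snd.comp continuous_subtype_val
  refine IsOpenEmbedding.of_continuous_injective_isOpenMap (hcont.comp continuous_subtype_val) ?_ ?_
  · rintro ⟨_, y, hy, rfl⟩ ⟨_, y', hy', rfl⟩ e
    have : (⟨y, hVU hy⟩ : U) = ⟨y', hVU hy'⟩ := hoe.injective e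
    obtain rfl := congrArg Subtype.val this
    rfl
  · refine IsOpenMap.domRestrict ?_ (isOpenMap_sigmaMk (σ := StagePullback F) _ hV)
    exact isOpenMap_sigma.2 fun j => (StagePullback.isLocalHomeomorph F j).isOpenMap

theorem stageMk.isLocalHomeomorph (F : I ⥤ EtaleMod.{u, w} R) (i : I) :
    IsLocalHomeomorph (stageMk F i) :=
  IsLocalHomeomorph.of_comp (g := TotalLim.proj F) (StagePullback.isLocalHomeomorph F i)
    (TotalLim.isLocalHomeomorph_proj F) (stageMk.continuous F i)

/-- A continuous map to the direct limit lifts locally to a stage of the system. -/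
theorem exists_local_lift (F : I ⥤ EtaleMod.{u, w} R) {W : Type*} [TopologicalSpace W]
    {t : W → TotalLim F} (ht : Continuous t) {i : I} {z : StagePullback F i} {y : W}
    (hz : stageMk F i z = t y) :
    ∃ N ∈ 𝓝 y, ∃ l : N → StagePullback F i, Continuous l ∧ ∀ v : N, stageMk F i (l v) = t v := by
  obtain ⟨e, he, h⟩ := stageMk.isLocalHomeomorph F i z
  -- The lift is a local inverse of the local homeomorphism `stageMk F i` composed with `t`.
  refine ⟨t ⁻¹' e.target, (e.open_target.preimage ht).mem_nhds ?_, fun v => e.symm (t v), ?_, ?_⟩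
  · change t y ∈ e.target
    rw [← hz, h]
    exact e.map_source he
  · exact e.continuousOn_symm.comp_continuous (ht.comp continuous_subtype_val) fun v => v.2
  · intro v
    rw [h]
    exact e.right_inv v.2

theorem stageMk_stageTransition (F : I ⥤ EtaleMod.{u, w} R) {i j : I} (h : i ≤ j)
    (z : StagePullback F i) : stageMk F j (stageTransition F i j h z) = stageMk F i z := by
  refine (stageMk_eq_iff F _ _).2 ⟨j, le_rfl, h, ?_⟩
  refine Subtype.ext (Prod.ext ?_ rfl)
  exact congrArg EtFibre.val (DirectedSystem.map_self'
    (fun i j h => fibreTransition F z.1.2 i j h) (fibreTransition F z.1.2 i j h ⟨z.1.1, z.2⟩))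

theorem exists_stageMk_eq (F : I ⥤ EtaleMod.{u, w} R) (t : TotalLim F) :
    ∃ (i : I) (z : StagePullback F i), stageMk F i z = t := by
  obtain ⟨⟨i, z⟩, rfl⟩ := Quotient.mk_surjective t
  exact ⟨i, z, rfl⟩

theorem exists_stageMk_eq₂ (F : I ⥤ EtaleMod.{u, w} R) (t t' : TotalLim F) :
    ∃ (i : I) (z z' : StagePullback F i), stageMk F i z = t ∧ stageMk F i z' = t' := by
  obtain ⟨i, z, rfl⟩ := exists_stageMk_eq F t
  obtain ⟨j, z', rfl⟩ := exists_stageMk_eq F t'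
  obtain ⟨k, h, h'⟩ := exists_ge_ge i j
  exact ⟨k, _, _, stageMk_stageTransition F h z, stageMk_stageTransition F h' z'⟩

/-- The canonical map of the fibre of `A_i` over `x_i` to the fibre of the direct limit
over `x`. -/
def fibreMk (F : I ⥤ EtaleMod.{u, w} R) (x : BaseLim F) (i : I)
    (a : (F.obj i).Fibre (BaseLim.π F i x)) : EtFibre (TotalLim.proj F) x :=
  ⟨TotalLim.mk F i x a, rfl⟩

theorem fibreMk_eq_iff (F : I ⥤ EtaleMod.{u, w} R) (x : BaseLim F) {i j : I}
    (a : (F.obj i).Fibre (BaseLim.π F i x)) (b : (F.obj j).Fibre (BaseLim.π F j x)) :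
    fibreMk F x i a = fibreMk F x j b ↔ ∃ (k : I) (h : i ≤ k) (h' : j ≤ k),
      fibreTransition F x i k h a = fibreTransition F x j k h' b := by
  refine EtFibre.ext_iff.trans ((stageMk_eq_iff F ⟨(a.1, x), a.2⟩ ⟨(b.1, x), b.2⟩).trans ?_)
  refine exists_congr fun k => exists_congr fun h => exists_congr fun h' => ?_
  exact ⟨fun e => EtFibre.ext (congrArg (fun z => z.1.1) e), fun e =>
    Subtype.ext (Prod.ext (congrArg EtFibre.val e) rfl)⟩

/-- The fibre of the direct limit over `x` is the direct limit of the fibres over `x_i`. -/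
noncomputable def fibreEquiv (F : I ⥤ EtaleMod.{u, w} R) (x : BaseLim F) :
    DirectLimit (fun i => (F.obj i).Fibre (BaseLim.π F i x)) (fun i j h => fibreTransition F x i j h)
      ≃ EtFibre (TotalLim.proj F) x :=
  Equiv.ofBijective
    (Quotient.lift (fun z => fibreMk F x z.1 z.2) fun _ _ ⟨k, h, h', e⟩ =>
      (fibreMk_eq_iff F x _ _).2 ⟨k, h, h', e⟩) (by
    refine ⟨?_, ?_⟩
    · rintro ⟨i, a⟩ ⟨j, b⟩ e
      obtain ⟨k, h, h', e⟩ := (fibreMk_eq_iff F x a b).1 e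
      exact Quotient.sound ⟨k, h, h', e⟩
    · rintro ⟨t, rfl⟩
      obtain ⟨i, z, rfl⟩ := exists_stageMk_eq F t
      exact ⟨Quotient.mk _ ⟨i, ⟨z.1.1, z.2⟩⟩, rfl⟩)

variable [Nonempty I]

/-- The structure is transported from the algebraic direct limit; non-emptiness of `I` supplies its
zero. -/
noncomputable instance (F : I ⥤ EtaleMod.{u, w} R) (x : BaseLim F) :
    AddCommGroup (EtFibre (TotalLim.proj F) x) :=
  (fibreEquiv F x).symm.addCommGroup

noncomputable instance (F : I ⥤ EtaleMod.{u, w} R) (x : BaseLim F) :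
    Module Rᵐᵒᵖ (EtFibre (TotalLim.proj F) x) :=
  (fibreEquiv F x).symm.module Rᵐᵒᵖ

/-- The map `fibreMk` as a linear map. -/
noncomputable def fibreMkLinear (F : I ⥤ EtaleMod.{u, w} R) (x : BaseLim F) (i : I) :
    (F.obj i).Fibre (BaseLim.π F i x) →ₗ[Rᵐᵒᵖ] EtFibre (TotalLim.proj F) x where
  toFun := fibreMk F x i
  map_add' a b := by
    refine (fibreEquiv F x).symm.injective ?_
    rw [Equiv.add_def]
    have : ∀ c, (fibreEquiv F x).symm (fibreMk F x i c) = Quotient.mk _ ⟨i, c⟩ := fun c =>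
      (fibreEquiv F x).symm_apply_eq.2 rfl
    rw [Equiv.symm_symm, Equiv.symm_apply_apply, this, this, this, DirectLimit.add_def]
  map_smul' r a := by
    refine (fibreEquiv F x).symm.injective ?_
    have : ∀ c, (fibreEquiv F x).symm (fibreMk F x i c) = Quotient.mk _ ⟨i, c⟩ := fun c =>
      (fibreEquiv F x).symm_apply_eq.2 rfl
    rw [Equiv.smul_def, Equiv.symm_symm, RingHom.id_apply, Equiv.symm_apply_apply, this, this,
      DirectLimit.smul_def]

end DirectedSystem

/-! ### Continuity of fibrewise operations. -/

/-- A map is continuous if it is so near every point. -/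
theorem continuous_of_forall_exists_nhds {X Y : Type*} [TopologicalSpace X] [TopologicalSpace Y]
    {f : X → Y}
    (h : ∀ x, ∃ N : Set X, N ∈ 𝓝 x ∧ Continuous fun v : ↥N => f v) : Continuous f :=
  continuous_iff_continuousAt.2 fun x =>
    let ⟨_, hN, hc⟩ := h x
    (continuousOn_iff_continuous_domRestrict.2 hc).continuousAt hN

namespace EtaleMod

variable {R : Type w} [Ring R] [TopologicalSpace R]

/-- The addition of the structure lives over the image of the second summand; `fibreCast` moves it
to the fibre over `b v`. -/
theorem continuous_add_fibre (E : EtaleMod.{u, w} R) {W : Type*} [TopologicalSpace W]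
    {b : W → E.base} {s t : ∀ v, E.Fibre (b v)} (hs : Continuous fun v => (s v).1)
    (ht : Continuous fun v => (t v).1) : Continuous fun v => (s v + t v).1 := by
  have h := E.str.continuous_add.comp (Continuous.subtype_mk
    (f := fun v => (((s v).1, (t v).1) : E.total × E.total))
    (Continuous.prodMk hs ht) fun v => (s v).2.trans (t v).2.symm)
  refine h.congr fun v => ?_
  exact congrArg EtFibre.val (map_add (E.fibreCast (t v).2) ⟨(s v).1, _⟩ ⟨(t v).1, rfl⟩)

theorem continuous_smul_fibre (E : EtaleMod.{u, w} R) {W : Type*} [TopologicalSpace W]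
    {b : W → E.base} {r : W → R} {s : ∀ v, E.Fibre (b v)} (hr : Continuous r)
    (hs : Continuous fun v => (s v).1) :
    Continuous fun v => (MulOpposite.op (r v) • s v).1 := by
  have h := E.str.continuous_smul.comp (Continuous.prodMk hs hr)
  refine h.congr fun v => ?_
  exact congrArg EtFibre.val
    (map_smul (E.fibreCast (s v).2) (MulOpposite.op (r v)) ⟨(s v).1, rfl⟩)

theorem Hom.continuous_fib_comp {E F : EtaleMod.{u, w} R} (f : E ⟶ F) {W : Type*}
    [TopologicalSpace W] {b : W → F.base} {s : ∀ v, E.Fibre (Hom.base f (b v))}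
    (hb : Continuous b) (hs : Continuous fun v => (s v).1) :
    Continuous fun v => (Hom.fib f (b v) (s v)).1 :=
  (Hom.continuous_fib f).comp (Continuous.subtype_mk
    (f := fun v => (((s v).1, b v) : E.total × F.base)) (hs.prodMk hb) fun v => (s v).2)

end EtaleMod

/-! ### Module structure and universal property of the direct limit. -/

section DirectedSystem

variable {R : Type w} [Ring R] [TopologicalSpace R] {I : Type u} [Preorder I]

/-- The map of bases induced by a cocone. -/
def baseDesc (F : I ⥤ EtaleMod.{u, w} R) (s : Cocone F) : C(s.pt.base, BaseLim F) where
  toFun y := ⟨fun i => Hom.base (s.ι.app i) y, fun i _ h =>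
    congrArg (fun f : F.obj i ⟶ s.pt => Hom.base f y) (s.w (homOfLE h))⟩
  continuous_toFun := Continuous.subtype_mk
    (continuous_pi fun i => map_continuous (Hom.base (s.ι.app i))) _

/-- The linear maps on the fibres given by a cocone. -/
def coconeFib (F : I ⥤ EtaleMod.{u, w} R) (s : Cocone F) (y : s.pt.base) (i : I) :
    (F.obj i).Fibre (BaseLim.π F i (baseDesc F s y)) →ₗ[Rᵐᵒᵖ] s.pt.Fibre y :=
  Hom.fib (s.ι.app i) y

theorem coconeFib_fibreTransition (F : I ⥤ EtaleMod.{u, w} R) (s : Cocone F) (y : s.pt.base) (i j : I)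
    (h : i ≤ j) (a : (F.obj i).Fibre (BaseLim.π F i (baseDesc F s y))) :
    coconeFib F s y j (fibreTransition F (baseDesc F s y) i j h a) = coconeFib F s y i a :=
  EtFibre.ext (Hom.fib_congr (f := F.map (homOfLE h) ≫ s.ι.app j) (s.w (homOfLE h)) rfl
    (a := ⟨a.1, a.2.trans ((baseDesc F s y).2 i j h).symm⟩) (b := a) rfl)

variable [IsDirectedOrder I]

theorem stageMk_proj (F : I ⥤ EtaleMod.{u, w} R) {i : I} (z : StagePullback F i) :
    TotalLim.proj F (stageMk F i z) = z.1.2 := rfl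

theorem proj_eq_of_stageMk_eq (F : I ⥤ EtaleMod.{u, w} R) {x : BaseLim F}
    {t : EtFibre (TotalLim.proj F) x} {i : I} {z : StagePullback F i}
    (h : stageMk F i z = t.1) : (F.obj i).proj z.1.1 = BaseLim.π F i x := by
  rw [z.2, ← t.2, ← h, stageMk_proj]

variable [Nonempty I]

/-- Turns a local lift in the total space into an equation inside a fibre, where linearity can be
used. -/
theorem eq_fibreMk_of_stageMk_eq (F : I ⥤ EtaleMod.{u, w} R) {x : BaseLim F}
    {t : EtFibre (TotalLim.proj F) x} {i : I} {z : StagePullback F i}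
    (h : stageMk F i z = t.1) : t = fibreMkLinear F x i ⟨z.1.1, proj_eq_of_stageMk_eq F h⟩ := by
  obtain ⟨t, rfl⟩ := t
  obtain rfl : _ = t := h
  rfl

theorem exists_fibreMk_eq (F : I ⥤ EtaleMod.{u, w} R) {x : BaseLim F}
    (t : EtFibre (TotalLim.proj F) x) : ∃ i a, fibreMkLinear F x i a = t := by
  obtain ⟨i, z, hz⟩ := exists_stageMk_eq F t.1
  exact ⟨i, _, (eq_fibreMk_of_stageMk_eq F hz).symm⟩

theorem continuous_fibreMk (F : I ⥤ EtaleMod.{u, w} R) (i : I) {W : Type*} [TopologicalSpace W]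
    {b : W → BaseLim F} {s : ∀ v, (F.obj i).Fibre (BaseLim.π F i (b v))} (hb : Continuous b)
    (hs : Continuous fun v => (s v).1) : Continuous fun v => (fibreMkLinear F (b v) i (s v)).1 :=
  (stageMk.continuous F i).comp (Continuous.subtype_mk
    (f := fun v => (((s v).1, b v) : (F.obj i).total × BaseLim F)) (hs.prodMk hb) fun v => (s v).2)

/-- The projection of the direct limit is an étale space of `R`-modules. -/
noncomputable def directLimitStr (F : I ⥤ EtaleMod.{u, w} R) :
    EtaleModStr R (TotalLim.proj F) where
  isLocalHomeomorph := TotalLim.isLocalHomeomorph_proj F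
  continuous_zero := by
    obtain ⟨i⟩ := ‹Nonempty I›
    refine (continuous_fibreMk F i (s := fun _ => 0) continuous_id ?_).congr fun x =>
      congrArg EtFibre.val (map_zero (fibreMkLinear F x i))
    exact (F.obj i).str.continuous_zero.comp (map_continuous (BaseLim.π F i))
  continuous_add := by
    refine continuous_of_forall_exists_nhds fun ⟨⟨t, t'⟩, h⟩ => ?_
    -- Both summands are lifted to the same stage, so that they can be added there before mapping to
    -- the limit.
    obtain ⟨i, z, z', hz, hz'⟩ := exists_stageMk_eq₂ F t t'
    obtain ⟨N, hN, l, hl, hl'⟩ := exists_local_lift F (y := ⟨(t, t'), h⟩)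
      (t := fun v : {z : TotalLim F × TotalLim F // TotalLim.proj F z.1 = TotalLim.proj F z.2} =>
        v.1.1) (continuous_fst.comp continuous_subtype_val) hz
    obtain ⟨M, hM, m, hm, hm'⟩ := exists_local_lift F (y := ⟨(t, t'), h⟩)
      (t := fun v : {z : TotalLim F × TotalLim F // TotalLim.proj F z.1 = TotalLim.proj F z.2} =>
        v.1.2) (continuous_snd.comp continuous_subtype_val) hz'
    refine ⟨N ∩ M, Filter.inter_mem hN hM, ?_⟩
    have hb : Continuous fun v : ↥(N ∩ M) => TotalLim.proj F v.1.1.2 :=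
      (TotalLim.isLocalHomeomorph_proj F).continuous.comp
        (continuous_snd.comp (continuous_subtype_val.comp continuous_subtype_val))
    have e₁ := fun v : ↥(N ∩ M) => eq_fibreMk_of_stageMk_eq F
      (t := (⟨v.1.1.1, v.1.2⟩ : EtFibre (TotalLim.proj F) (TotalLim.proj F v.1.1.2)))
      (hl' ⟨v.1, v.2.1⟩)
    have e₂ := fun v : ↥(N ∩ M) => eq_fibreMk_of_stageMk_eq F
      (t := (⟨v.1.1.2, rfl⟩ : EtFibre (TotalLim.proj F) (TotalLim.proj F v.1.1.2)))
      (hm' ⟨v.1, v.2.2⟩)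
    refine (continuous_fibreMk F i hb ((F.obj i).continuous_add_fibre ?_ ?_)).congr fun v =>
      congrArg EtFibre.val ((map_add (fibreMkLinear F _ i) _ _).trans
        (congrArg₂ (· + ·) (e₁ v).symm (e₂ v).symm))
    · exact continuous_fst.comp (continuous_subtype_val.comp
        (hl.comp (continuous_subtype_val.subtype_mk fun v => v.2.1)))
    · exact continuous_fst.comp (continuous_subtype_val.comp
        (hm.comp (continuous_subtype_val.subtype_mk fun v => v.2.2)))
  continuous_smul := by
    refine continuous_of_forall_exists_nhds fun ⟨t, r⟩ => ?_
    obtain ⟨i, z, hz⟩ := exists_stageMk_eq F t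
    obtain ⟨N, hN, l, hl, hl'⟩ := exists_local_lift F (y := (t, r))
      (t := fun v : TotalLim F × R => v.1) continuous_fst hz
    refine ⟨N, hN, ?_⟩
    have hb : Continuous fun v : N => TotalLim.proj F v.1.1 :=
      (TotalLim.isLocalHomeomorph_proj F).continuous.comp
        (continuous_fst.comp continuous_subtype_val)
    have e := fun v : N => eq_fibreMk_of_stageMk_eq F
      (t := (⟨v.1.1, rfl⟩ : EtFibre (TotalLim.proj F) (TotalLim.proj F v.1.1))) (hl' v)
    refine (continuous_fibreMk F i hb ((F.obj i).continuous_smul_fibre (r := fun v : N => v.1.2)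
      (continuous_snd.comp continuous_subtype_val) ?_)).congr fun v =>
      congrArg EtFibre.val ((map_smul (fibreMkLinear F _ i) _ _).trans
        (congrArg (MulOpposite.op v.1.2 • ·) (e v).symm))
    exact continuous_fst.comp (continuous_subtype_val.comp hl)

/-- The canonical morphism of `A_i` to the direct limit. -/
noncomputable def toDirectLimit (F : I ⥤ EtaleMod.{u, w} R) (i : I) :
    F.obj i ⟶ directLimit F (directLimitStr F) where
  base := BaseLim.π F i
  fib x := fibreMkLinear F x i
  continuous_fib := stageMk.continuous F i

theorem fibreMk_fibreTransition (F : I ⥤ EtaleMod.{u, w} R) {i j : I} (h : i ≤ j) (x : BaseLim F)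
    (a : (F.obj i).Fibre (BaseLim.π F i x)) :
    fibreMkLinear F x j (fibreTransition F x i j h a) = fibreMkLinear F x i a :=
  EtFibre.ext (stageMk_stageTransition F h ⟨(a.1, x), a.2⟩)

/-- The cocone of the direct limit. -/
noncomputable def directLimitι (F : I ⥤ EtaleMod.{u, w} R) :
    F ⟶ (Functor.const I).obj (directLimit F (directLimitStr F)) where
  app := toDirectLimit F
  naturality i j f := by
    refine Hom.ext_val (fun x => x.2 i j (leOfHom f)) fun x a b hab => ?_
    exact (congrArg EtFibre.val (fibreMk_fibreTransition F (leOfHom f) x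
      ⟨a.1, a.2.trans (x.2 i j (leOfHom f))⟩)).trans (congrArg (fun b => (fibreMk F x i b).1)
        (EtFibre.ext hab))

/-- The linear map on a fibre of the direct limit given by compatible linear maps on the fibres of
the system. -/
noncomputable def fibreDesc (F : I ⥤ EtaleMod.{u, w} R) (x : BaseLim F) {P : Type*}
    [AddCommGroup P] [Module Rᵐᵒᵖ P] (g : ∀ i, (F.obj i).Fibre (BaseLim.π F i x) →ₗ[Rᵐᵒᵖ] P)
    (hg : ∀ i j (h : i ≤ j) a, g j (fibreTransition F x i j h a) = g i a) :
    EtFibre (TotalLim.proj F) x →ₗ[Rᵐᵒᵖ] P :=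
  (DirectLimit.Module.lift Rᵐᵒᵖ I _ (fun i j h => fibreTransition F x i j h) g hg).comp
    ((fibreEquiv F x).symm.linearEquiv Rᵐᵒᵖ).toLinearMap

theorem fibreDesc_fibreMk (F : I ⥤ EtaleMod.{u, w} R) (x : BaseLim F) {P : Type*}
    [AddCommGroup P] [Module Rᵐᵒᵖ P] (g : ∀ i, (F.obj i).Fibre (BaseLim.π F i x) →ₗ[Rᵐᵒᵖ] P)
    (hg : ∀ i j h a, g j (fibreTransition F x i j h a) = g i a) (i : I)
    (a : (F.obj i).Fibre (BaseLim.π F i x)) :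
    fibreDesc F x g hg (fibreMkLinear F x i a) = g i a := by
  have : (fibreEquiv F x).symm (fibreMk F x i a) = Quotient.mk _ ⟨i, a⟩ :=
    (fibreEquiv F x).symm_apply_eq.2 rfl
  exact congrArg (DirectLimit.Module.lift Rᵐᵒᵖ I _ (fun i j h => fibreTransition F x i j h) g hg)
    this

/-- The morphism from the direct limit induced by a cocone. -/
noncomputable def directLimitDesc (F : I ⥤ EtaleMod.{u, w} R) (s : Cocone F) :
    directLimit F (directLimitStr F) ⟶ s.pt where
  base := baseDesc F s
  fib y := fibreDesc F (baseDesc F s y) (coconeFib F s y)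
    (coconeFib_fibreTransition F s y)
  continuous_fib := by
    refine continuous_of_forall_exists_nhds fun z => ?_
    obtain ⟨i, a, ha⟩ := exists_stageMk_eq F z.1.1
    obtain ⟨N, hN, l, hl, hl'⟩ := exists_local_lift F (y := z)
      (t := fun v : {z : TotalLim F × s.pt.base // TotalLim.proj F z.1 = baseDesc F s z.2} =>
        v.1.1) (continuous_fst.comp continuous_subtype_val) ha
    refine ⟨N, hN, ?_⟩
    have e := fun v : N => eq_fibreMk_of_stageMk_eq F
      (t := (⟨v.1.1.1, v.1.2⟩ : EtFibre (TotalLim.proj F) (baseDesc F s v.1.1.2))) (hl' v)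
    -- Along a local lift to stage `i`, the induced map is the cocone map of stage `i`, which is
    -- continuous.
    refine (Hom.continuous_fib_comp (s.ι.app i) (b := fun v : N => v.1.1.2)
      (s := fun v => ⟨(l v).1.1, proj_eq_of_stageMk_eq F (x := baseDesc F s v.1.1.2)
        (t := ⟨v.1.1.1, v.1.2⟩) (hl' v)⟩) ?_ ?_).congr fun v => ?_
    · exact continuous_snd.comp (continuous_subtype_val.comp continuous_subtype_val)
    · exact continuous_fst.comp (continuous_subtype_val.comp hl)
    · exact congrArg EtFibre.val ((fibreDesc_fibreMk F (baseDesc F s v.1.1.2)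
        (coconeFib F s v.1.1.2) (coconeFib_fibreTransition F s v.1.1.2) i _).symm.trans
          (congrArg _ (e v).symm))

theorem directLimitDesc_fib_fibreMk (F : I ⥤ EtaleMod.{u, w} R) (s : Cocone F) (y : s.pt.base)
    (i : I) (a : (F.obj i).Fibre (BaseLim.π F i (baseDesc F s y))) :
    Hom.fib (directLimitDesc F s) y (fibreMkLinear F (baseDesc F s y) i a) =
      coconeFib F s y i a :=
  fibreDesc_fibreMk F (baseDesc F s y) (coconeFib F s y)
    (coconeFib_fibreTransition F s y) i a

/-- The direct limit is the colimit in the category of étale spaces of `R`-modules. -/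
noncomputable def directLimitIsColimit (F : I ⥤ EtaleMod.{u, w} R) :
    IsColimit (Cocone.mk (directLimit F (directLimitStr F)) (directLimitι F)) where
  desc := directLimitDesc F
  fac s i := by
    refine Hom.ext_val (fun y => rfl) fun y a b hab => ?_
    obtain rfl : a = b := EtFibre.ext hab
    exact congrArg EtFibre.val (directLimitDesc_fib_fibreMk F s y i a)
  uniq s m hm := by
    have hb : ∀ y, Hom.base m y = baseDesc F s y := fun y => Subtype.ext (funext fun i =>
      congrArg (fun f : F.obj i ⟶ s.pt => Hom.base f y) (hm i))
    refine Hom.ext_val hb fun y a b hab => ?_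
    obtain ⟨i, c, rfl⟩ := exists_fibreMk_eq F a
    have hc : (F.obj i).proj c.1 = BaseLim.π F i (baseDesc F s y) :=
      c.2.trans (congrArg (BaseLim.π F i) (hb y))
    -- The two base maps agree only propositionally, so the representative `c` is moved to the fibre
    -- over `baseDesc F s y`.
    have hbc : b = fibreMkLinear F (baseDesc F s y) i ⟨c.1, hc⟩ :=
      eq_fibreMk_of_stageMk_eq F (z := ⟨(c.1, Hom.base m y), c.2⟩) hab
    rw [hbc]
    refine Eq.trans ?_ (congrArg EtFibre.val (directLimitDesc_fib_fibreMk F s y i ⟨c.1, hc⟩)).symm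
    exact Hom.fib_congr (f := toDirectLimit F i ≫ m) (hm i) rfl (a := c) (b := ⟨c.1, hc⟩) rfl

end DirectedSystem

/-! ### Directed colimits of modules, and the supply of global sections. -/

/-- A directed cocone of modules which is jointly surjective and identifies only what is already
identified at some stage is a colimit. -/
theorem ModuleCat.nonempty_isColimit_of_directed {S : Type*} [Ring S] {I : Type*} [Preorder I]
    [IsDirectedOrder I] {G : I ⥤ ModuleCat.{u} S} (c : Cocone G)
    (hsurj : ∀ m : c.pt, ∃ i, ∃ a : G.obj i, (c.ι.app i).hom a = m)
    (hinj : ∀ i, ∀ a : G.obj i, (c.ι.app i).hom a = 0 →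
      ∃ (k : I) (h : i ≤ k), (G.map (homOfLE h)).hom a = 0) : Nonempty (IsColimit c) := by
  have hw : ∀ (s : Cocone G) {i k : I} (h : i ≤ k) (a : G.obj i),
      (s.ι.app k).hom ((G.map (homOfLE h)).hom a) = (s.ι.app i).hom a := fun s i k h a =>
    congrArg (fun f : G.obj i ⟶ s.pt => f.hom a) (s.w (homOfLE h))
  have key : ∀ (s : Cocone G) (i : I) (a b : G.obj i),
      (c.ι.app i).hom a = (c.ι.app i).hom b → (s.ι.app i).hom a = (s.ι.app i).hom b := by
    intro s i a b e
    obtain ⟨k, h, hk⟩ := hinj i (a - b) (by rw [map_sub, e, sub_self])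
    rw [← sub_eq_zero, ← map_sub, ← hw s h, hk, map_zero]
  have key₂ : ∀ (s : Cocone G) (i j : I) (a : G.obj i) (b : G.obj j),
      (c.ι.app i).hom a = (c.ι.app j).hom b → (s.ι.app i).hom a = (s.ι.app j).hom b := by
    intro s i j a b e
    obtain ⟨k, h, h'⟩ := exists_ge_ge i j
    rw [← hw s h, ← hw s h']
    exact key s k _ _ (by rw [hw c h, hw c h', e])
  -- The induced map is defined on chosen representatives; `hd` shows independence of the choice,
  -- whence linearity.
  choose idx rep hrep using hsurj
  have hd : ∀ (s : Cocone G) (i : I) (a : G.obj i) (m : c.pt), (c.ι.app i).hom a = m →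
      (s.ι.app _).hom (rep m) = (s.ι.app i).hom a := fun s i a m e =>
    key₂ s _ _ _ _ ((hrep m).trans e.symm)
  let desc : ∀ s : Cocone G, c.pt →ₗ[S] s.pt := fun s =>
    { toFun := fun m => (s.ι.app _).hom (rep m)
      map_add' := fun m n => by
        obtain ⟨k, h, h'⟩ := exists_ge_ge (idx m) (idx n)
        rw [hd s k ((G.map (homOfLE h)).hom (rep m) + (G.map (homOfLE h')).hom (rep n)) (m + n)
          (by rw [map_add, hw c h, hw c h', hrep, hrep]), map_add, hw s h, hw s h']
      map_smul' := fun r m => by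
        rw [hd s _ (r • rep m) (r • m) (by rw [map_smul, hrep]), map_smul]
        rfl }
  refine ⟨{ desc := fun s => ModuleCat.ofHom (desc s), fac := fun s i => ?_, uniq := fun s m hm => ?_ }⟩
  · ext a
    exact hd s i a _ rfl
  · ext x
    change m.hom x = (s.ι.app _).hom (rep x)
    rw [← hm]
    exact congrArg m.hom (hrep x).symm

theorem IsClopen.continuous_of_continuousOn {X Y : Type*} [TopologicalSpace X]
    [TopologicalSpace Y] {f : X → Y} {U : Set X} (hU : IsClopen U) (h : ContinuousOn f U)
    (h' : ContinuousOn f Uᶜ) : Continuous f :=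
  continuous_iff_continuousAt.2 fun x => by
    by_cases hx : x ∈ U
    · exact h.continuousAt (hU.isOpen.mem_nhds hx)
    · exact h'.continuousAt (hU.compl.isOpen.mem_nhds hx)

namespace EtaleMod

variable {R : Type w} [Ring R] [TopologicalSpace R]

/-- Local injectivity of the projection makes agreement at a point spread to a neighbourhood. -/
theorem isOpen_eqLocus (E : EtaleMod.{u, w} R) (s t : E.sections) :
    IsOpen {x | s.1 x = t.1 x} := by
  have h := E.str.isLocalHomeomorph.isLocallyInjective.isOpen_eqLocus
    (g₁ := fun x => (s.1 x).1) (g₂ := fun x => (t.1 x).1) s.2 t.2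
    (funext fun x => (s.1 x).2.trans (t.1 x).2.symm)
  convert h using 3 with x
  exact EtFibre.ext_iff

/-- Two sections can be glued along a clopen set and its complement. -/
theorem exists_section_glue (E : EtaleMod.{u, w} R) (s t : E.sections) {U : Set E.base}
    (hU : IsClopen U) :
    ∃ r : E.sections, (∀ x ∈ U, r.1 x = s.1 x) ∧ ∀ x ∉ U, r.1 x = t.1 x := by
  classical
  have hs : Continuous fun x => (s.1 x).1 := s.2
  have ht : Continuous fun x => (t.1 x).1 := t.2
  refine ⟨⟨fun x => if x ∈ U then s.1 x else t.1 x,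
    hU.continuous_of_continuousOn (hs.continuousOn.congr fun x hx => ?_)
      (ht.continuousOn.congr fun x hx => ?_)⟩, fun x hx => if_pos hx, fun x hx => if_neg hx⟩
  · exact congrArg EtFibre.val (if_pos hx)
  · exact congrArg EtFibre.val (if_neg hx)

/-- Every point of an étale space lies on a global section. -/
theorem exists_section_through (E : EtaleMod.{u, w} R) {x : E.base} (a : E.Fibre x) :
    ∃ s : E.sections, s.1 x = a := by
  classical
  obtain ⟨e, he, h⟩ := E.str.isLocalHomeomorph a.1
  have hx : x ∈ e.target := by
    have := e.map_source he
    rwa [← h, a.2] at this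
  obtain ⟨U, hU, hxU, hUe⟩ := compact_exists_isClopen_in_isOpen e.open_target hx
  have hz : Continuous fun x => ((0 : E.sections).1 x).1 := (0 : E.sections).2
  have hr : ∀ y ∈ U, E.proj (e.symm y) = y := fun y hy => by
    rw [h]
    exact e.right_inv (hUe hy)
  -- A local inverse of the projection through `a`, cut down to a clopen set and extended by zero.
  refine ⟨⟨fun y => if hy : y ∈ U then ⟨e.symm y, hr y hy⟩ else 0,
    hU.continuous_of_continuousOn ((e.continuousOn_symm.mono hUe).congr fun y hy => ?_)
      (hz.continuousOn.congr fun y hy => ?_)⟩, ?_⟩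
  · exact congrArg EtFibre.val (dif_pos hy)
  · exact congrArg EtFibre.val (dif_neg hy)
  · refine (dif_pos hxU).trans (EtFibre.ext ?_)
    change e.symm x = a.1
    have := e.left_inv he
    rwa [← h, a.2] at this

theorem sections_val_congr (E : EtaleMod.{u, w} R) (s : E.sections) {x y : E.base} (h : x = y) :
    (s.1 x).1 = (s.1 y).1 := by
  rw [h]

end EtaleMod

/-! ### The continuous product of the direct limit. -/

section DirectedSystem

variable {R : Type w} [Ring R] [TopologicalSpace R] {I : Type u} [Preorder I]

theorem sectionsMap_map_map (F : I ⥤ EtaleMod.{u, w} R) {i j k : I} (h : i ≤ j) (h' : j ≤ k)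
    (s : (F.obj i).sections) :
    sectionsMap (F.map (homOfLE h')) (sectionsMap (F.map (homOfLE h)) s) =
      sectionsMap (F.map (homOfLE (h.trans h'))) s :=
  congrArg (fun f : F.obj i ⟶ F.obj k => sectionsMap f s)
    (F.map_comp (homOfLE h) (homOfLE h')).symm

theorem sectionsMap_map_apply (F : I ⥤ EtaleMod.{u, w} R) {i k : I} (h : i ≤ k)
    (s : (F.obj i).sections) (x : BaseLim F) :
    (sectionsMap (F.map (homOfLE h)) s).1 (BaseLim.π F k x) =
      fibreTransition F x i k h (s.1 (BaseLim.π F i x)) :=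
  EtFibre.ext (Hom.fib_congr rfl rfl (sections_val_congr _ s (x.2 i k h)))

variable [IsDirectedOrder I]

/-- Since the system is directed, a neighbourhood in the limit contains one pulled back from a
single stage, which can be moved beyond `i` and shrunk to a clopen set. -/
theorem BaseLim.exists_isClopen_preimage_subset [Nonempty I] (F : I ⥤ EtaleMod.{u, w} R)
    (x : BaseLim F) {N : Set (BaseLim F)} (hN : N ∈ 𝓝 x) (i : I) :
    ∃ (k : I) (_ : i ≤ k) (U : Set (F.obj k).base), IsClopen U ∧ BaseLim.π F k x ∈ U ∧
      BaseLim.π F k ⁻¹' U ⊆ N := by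
  have hle : ∀ {i j : I}, i ≤ j → Filter.comap (BaseLim.π F j) (𝓝 (BaseLim.π F j x)) ≤
      Filter.comap (BaseLim.π F i) (𝓝 (BaseLim.π F i x)) := by
    intro i j h
    have e : (BaseLim.π F i : BaseLim F → (F.obj i).base) =
        Hom.base (F.map (homOfLE h)) ∘ BaseLim.π F j := funext fun x => (x.2 i j h).symm
    rw [e, ← Filter.comap_comap]
    exact Filter.comap_mono
      ((map_continuous (Hom.base (F.map (homOfLE h)))).tendsto (BaseLim.π F j x)).le_comap
  have hnhds : 𝓝 x = ⨅ i, Filter.comap (BaseLim.π F i) (𝓝 (BaseLim.π F i x)) := by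
    have e : 𝓝 x = Filter.comap Subtype.val (𝓝 x.1) := nhds_induced _ _
    rw [e, nhds_pi, Filter.pi, Filter.comap_iInf]
    exact iInf_congr fun i => Filter.comap_comap
  rw [hnhds, Filter.mem_iInf_of_directed fun i j => by
    obtain ⟨k, h, h'⟩ := exists_ge_ge i j
    exact ⟨k, hle h, hle h'⟩] at hN
  obtain ⟨j, hj⟩ := hN
  obtain ⟨k, h, h'⟩ := exists_ge_ge i j
  obtain ⟨V, hV, hVN⟩ := hle h' hj
  obtain ⟨W, hWV, hW, hxW⟩ := mem_nhds_iff.1 hV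
  obtain ⟨U, hU, hxU, hUW⟩ := compact_exists_isClopen_in_isOpen hW hxW
  exact ⟨k, h, U, hU, hxU, fun y hy => hVN (hWV (hUW hy))⟩

/-- A neighbourhood of the image of the inverse limit contains the image of some stage. -/
theorem BaseLim.exists_base_mem (F : I ⥤ EtaleMod.{u, w} R) (j : I) {V : Set (F.obj j).base}
    (hV : IsOpen V) (h : ∀ x, BaseLim.π F j x ∈ V) :
    ∃ (k : I) (hk : j ≤ k), ∀ y, Hom.base (F.map (homOfLE hk)) y ∈ V := by
  classical
  by_contra! hcon
  have hne : ∀ i, Nonempty (F.obj i).base := fun i => by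
    obtain ⟨k, hi, hj⟩ := exists_ge_ge i j
    obtain ⟨y, -⟩ := hcon k hj
    exact ⟨Hom.base (F.map (homOfLE hi)) y⟩
  have hcomp : ∀ {a b c : I} (h : a ≤ b) (h' : b ≤ c) (y : (F.obj c).base),
      Hom.base (F.map (homOfLE h)) (Hom.base (F.map (homOfLE h')) y) =
        Hom.base (F.map (homOfLE (h.trans h'))) y := by
    intro a b c h h' y
    have e : F.map (homOfLE (h.trans h')) = F.map (homOfLE h) ≫ F.map (homOfLE h') := by
      rw [← F.map_comp]
      rfl
    rw [e]
    rfl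
  -- Families compatible up to stage `k` whose `j`-th coordinate avoids `V`: closed and decreasing
  -- in `k`. A common point would be a point of the limit outside `V`.
  let T : {k // j ≤ k} → Set (∀ i, (F.obj i).base) := fun k =>
    {x | ∀ (a b : I) (h : a ≤ b), b ≤ k.1 → Hom.base (F.map (homOfLE h)) (x b) = x a} ∩
      (fun x => x j) ⁻¹' Vᶜ
  have hclosed : ∀ k, IsClosed (T k) := fun k => by
    refine IsClosed.inter ?_ (hV.isClosed_compl.preimage (continuous_apply j))
    simp only [Set.ofPred_forall]
    refine isClosed_iInter fun a => isClosed_iInter fun b => isClosed_iInter fun h =>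
      isClosed_iInter fun _ => ?_
    exact isClosed_eq ((map_continuous _).comp (continuous_apply b)) (continuous_apply a)
  have hnonempty : ∀ k, (T k).Nonempty := by
    rintro ⟨k, hk⟩
    obtain ⟨y, hy⟩ := hcon k hk
    -- Coordinates at indices not below `k` are arbitrary, since `T k` does not constrain them.
    refine ⟨fun a => if h : a ≤ k then Hom.base (F.map (homOfLE h)) y else
      Classical.choice (hne a), fun a b h hb => ?_, ?_⟩
    · dsimp only
      rw [dif_pos hb, dif_pos (h.trans hb), hcomp]
    · rw [Set.mem_preimage]
      dsimp only
      rw [dif_pos hk]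
      exact hy
  have : Nonempty {k // j ≤ k} := ⟨⟨j, le_rfl⟩⟩
  obtain ⟨x, hx⟩ := IsCompact.nonempty_iInter_of_directed_nonempty_isCompact_isClosed T (by
      rintro ⟨k, hk⟩ ⟨l, hl⟩
      obtain ⟨m, h, h'⟩ := exists_ge_ge k l
      exact ⟨⟨m, hk.trans h⟩, fun x hx => ⟨fun a b hab hb => hx.1 a b hab (hb.trans h), hx.2⟩,
        fun x hx => ⟨fun a b hab hb => hx.1 a b hab (hb.trans h'), hx.2⟩⟩)
    hnonempty (fun k => (hclosed k).isCompact) hclosed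
  rw [Set.mem_iInter] at hx
  refine (hx ⟨j, le_rfl⟩).2 (h ⟨x, fun a b hab => ?_⟩)
  obtain ⟨m, h, h'⟩ := exists_ge_ge b j
  exact (hx ⟨m, h'⟩).1 a b hab h

variable [Nonempty I]

theorem sectionsMap_toDirectLimit (F : I ⥤ EtaleMod.{u, w} R) {i k : I} (h : i ≤ k)
    (s : (F.obj i).sections) :
    sectionsMap (toDirectLimit F k) (sectionsMap (F.map (homOfLE h)) s) =
      sectionsMap (toDirectLimit F i) s :=
  congrArg (fun f : F.obj i ⟶ directLimit F (directLimitStr F) => sectionsMap f s)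
    ((directLimitι F).naturality (homOfLE h))

theorem exists_sectionsMap_toDirectLimit_eq (F : I ⥤ EtaleMod.{u, w} R)
    (s : (directLimit F (directLimitStr F)).sections) :
    ∃ (i : I) (t : (F.obj i).sections), sectionsMap (toDirectLimit F i) t = s := by
  -- Compact induction needs agreement on a clopen set of the stage itself, so that two partial
  -- solutions can be glued there.
  suffices h : ∃ (i : I) (t : (F.obj i).sections) (U : Set (F.obj i).base), IsClopen U ∧
      Set.univ ⊆ BaseLim.π F i ⁻¹' U ∧
      ∀ x, BaseLim.π F i x ∈ U → (sectionsMap (toDirectLimit F i) t).1 x = s.1 x by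
    obtain ⟨i, t, U, -, hU, h⟩ := h
    exact ⟨i, t, Subtype.ext (funext fun x => h x (hU trivial))⟩
  have hmono : ∀ {i k : I} (h : i ≤ k) (t : (F.obj i).sections) (x : BaseLim F),
      (sectionsMap (toDirectLimit F k) (sectionsMap (F.map (homOfLE h)) t)).1 x =
        (sectionsMap (toDirectLimit F i) t).1 x := fun h t x => by
    rw [sectionsMap_toDirectLimit]
  have hpre : ∀ {i k : I} (h : i ≤ k) (U : Set (F.obj i).base) (x : BaseLim F),
      BaseLim.π F k x ∈ Hom.base (F.map (homOfLE h)) ⁻¹' U ↔ BaseLim.π F i x ∈ U :=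
    fun {i k} h U x => by
      rw [Set.mem_preimage, show Hom.base (F.map (homOfLE h)) (BaseLim.π F k x) =
        BaseLim.π F i x from x.2 i k h]
  refine isCompact_univ.induction_on (p := fun K : Set (BaseLim F) =>
    ∃ (i : I) (t : (F.obj i).sections) (U : Set (F.obj i).base), IsClopen U ∧
      K ⊆ BaseLim.π F i ⁻¹' U ∧
      ∀ x, BaseLim.π F i x ∈ U → (sectionsMap (toDirectLimit F i) t).1 x = s.1 x) ?_ ?_ ?_ ?_
  · obtain ⟨i⟩ := ‹Nonempty I›
    exact ⟨i, 0, ∅, isClopen_empty, Set.empty_subset _, fun x hx => hx.elim⟩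
  · rintro K L hKL ⟨i, t, U, hU, hL, h⟩
    exact ⟨i, t, U, hU, hKL.trans hL, h⟩
  · rintro K L ⟨i, t, U, hU, hK, ht⟩ ⟨j, t', U', hU', hL, ht'⟩
    obtain ⟨k, h, h'⟩ := exists_ge_ge i j
    have hc := hU.preimage (map_continuous (Hom.base (F.map (homOfLE h))))
    have hc' := hU'.preimage (map_continuous (Hom.base (F.map (homOfLE h'))))
    -- On the overlap the first section is used; over `X` both have image `s` there.
    obtain ⟨r, hr, hr'⟩ := (F.obj k).exists_section_glue (sectionsMap (F.map (homOfLE h)) t)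
      (sectionsMap (F.map (homOfLE h')) t') hc
    refine ⟨k, r, _, hc.union hc', Set.union_subset (fun x hx => Or.inl ((hpre h U x).2 (hK hx)))
      (fun x hx => Or.inr ((hpre h' U' x).2 (hL hx))), fun x hx => ?_⟩
    change fibreMkLinear F x k (r.1 (BaseLim.π F k x)) = _
    by_cases hxU : BaseLim.π F k x ∈ Hom.base (F.map (homOfLE h)) ⁻¹' U
    · rw [hr _ hxU, ← ht x ((hpre h U x).1 hxU), ← hmono h]
      rfl
    · rw [hr' _ hxU, ← ht' x ((hpre h' U' x).1 (hx.resolve_left hxU)), ← hmono h']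
      rfl
  · intro x _
    obtain ⟨i, a, ha⟩ := exists_fibreMk_eq F (s.1 x)
    obtain ⟨t, ht⟩ := (F.obj i).exists_section_through a
    have hx : (sectionsMap (toDirectLimit F i) t).1 x = s.1 x := by
      rw [← ha, ← ht]
      rfl
    obtain ⟨k, h, U, hU, hxU, hUN⟩ := BaseLim.exists_isClopen_preimage_subset F x
      ((isOpen_eqLocus _ (sectionsMap (toDirectLimit F i) t) s).mem_nhds hx) i
    refine ⟨BaseLim.π F k ⁻¹' U, mem_nhdsWithin_of_mem_nhds
      ((hU.isOpen.preimage (map_continuous _)).mem_nhds hxU), k, sectionsMap (F.map (homOfLE h)) t,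
      U, hU, subset_rfl, fun y hy => (hmono h t y).trans (hUN hy)⟩

theorem exists_sectionsMap_map_eq_zero (F : I ⥤ EtaleMod.{u, w} R) {i : I}
    (s : (F.obj i).sections) (hs : sectionsMap (toDirectLimit F i) s = 0) :
    ∃ (k : I) (h : i ≤ k), sectionsMap (F.map (homOfLE h)) s = 0 := by
  have hmono : ∀ {j k : I} (h : i ≤ j) (h' : j ≤ k) (x : BaseLim F),
      (sectionsMap (F.map (homOfLE h)) s).1 (BaseLim.π F j x) = 0 →
        (sectionsMap (F.map (homOfLE (h.trans h'))) s).1 (BaseLim.π F k x) = 0 := by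
    intro j k h h' x hx
    rw [← sectionsMap_map_map F h h', sectionsMap_map_apply, hx, map_zero]
  have hcompact : ∃ (k : I) (h : i ≤ k), ∀ x ∈ (Set.univ : Set (BaseLim F)),
      (sectionsMap (F.map (homOfLE h)) s).1 (BaseLim.π F k x) = 0 := by
    refine isCompact_univ.induction_on (p := fun K : Set (BaseLim F) =>
      ∃ (k : I) (h : i ≤ k), ∀ x ∈ K,
        (sectionsMap (F.map (homOfLE h)) s).1 (BaseLim.π F k x) = 0) ?_ ?_ ?_ ?_
    · exact ⟨i, le_rfl, fun x hx => hx.elim⟩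
    · rintro K L hKL ⟨k, h, hk⟩
      exact ⟨k, h, fun x hx => hk x (hKL hx)⟩
    · rintro K L ⟨k, h, hk⟩ ⟨l, h', hl⟩
      obtain ⟨m, g, g'⟩ := exists_ge_ge k l
      refine ⟨m, h.trans g, fun x hx => hx.elim (fun hx => ?_) fun hx => ?_⟩
      · exact hmono h g x (hk x hx)
      · exact hmono h' g' x (hl x hx)
    · intro x _
      have hx : fibreMkLinear F x i (s.1 (BaseLim.π F i x)) = fibreMkLinear F x i 0 := by
        rw [map_zero]
        exact congrFun (congrArg Subtype.val hs) x
      obtain ⟨k, h, h', e⟩ := (fibreMk_eq_iff F x _ _).1 hx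
      rw [map_zero, ← sectionsMap_map_apply] at e
      exact ⟨_, mem_nhdsWithin_of_mem_nhds
        ((((F.obj k).isOpen_eqLocus (sectionsMap (F.map (homOfLE h)) s) 0).preimage
          (map_continuous (BaseLim.π F k))).mem_nhds e), k, h, fun y hy => hy⟩
  obtain ⟨k, h, hk⟩ := hcompact
  -- So far the section vanishes only on the image of `X` in `X_k`; passing to `l` gives vanishing
  -- on all of the base.
  obtain ⟨l, h', hl⟩ := BaseLim.exists_base_mem F k
    ((F.obj k).isOpen_eqLocus (sectionsMap (F.map (homOfLE h)) s) 0) fun x => hk x trivial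
  refine ⟨l, h.trans h', ?_⟩
  rw [← sectionsMap_map_map F h h']
  refine Subtype.ext (funext fun y => ?_)
  exact (congrArg (Hom.fib (F.map (homOfLE h')) y) (hl y)).trans (map_zero _)

end DirectedSystem

theorem mainTheorem9 {R : Type w} [Ring R] [TopologicalSpace R] [IsTopologicalRing R]
    [CompactSpace R] [T2Space R] [TotallyDisconnectedSpace R]
    {I : Type u} [Preorder I] [IsDirectedOrder I] [Nonempty I] (F : I ⥤ EtaleMod.{u, w} R) :
    ∃ (S : EtaleModStr R (TotalLim.proj F))
      (ι : F ⟶ (Functor.const I).obj (directLimit F S)),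
      (∀ i : I, EtaleMod.Hom.base (ι.app i) = BaseLim.π F i) ∧
      (∀ (i : I) (x : BaseLim F)
        (h : EtaleMod.Hom.base (ι.app i) x = BaseLim.π F i x)
        (a : (F.obj i).Fibre (EtaleMod.Hom.base (ι.app i) x)),
        (EtaleMod.Hom.fib (ι.app i) x a).1 = TotalLim.mk F i x ⟨a.1, a.2.trans h⟩) ∧
      Nonempty (IsColimit (Cocone.mk (directLimit F S) ι)) ∧
      Nonempty (IsColimit ((contProd R).mapCocone (Cocone.mk (directLimit F S) ι))) ∧
      Nonempty (IsColimit ((contProd R ⋙ (IsDiscreteModule.{u, w} R).ι).mapCocone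
        (Cocone.mk (directLimit F S) ι))) := by

  refine ⟨directLimitStr F, directLimitι F, fun _ => rfl, fun i x _ a => rfl,
    ⟨directLimitIsColimit F⟩, ?_⟩
  obtain ⟨hc⟩ : Nonempty (IsColimit ((contProd R ⋙ (IsDiscreteModule.{u, w} R).ι).mapCocone
      (Cocone.mk (directLimit F (directLimitStr F)) (directLimitι F)))) :=
    ModuleCat.nonempty_isColimit_of_directed _ (exists_sectionsMap_toDirectLimit_eq F)
      fun _ => exists_sectionsMap_map_eq_zero F
  -- The inclusion of the full subcategory of discrete modules reflects colimits.
  exact ⟨⟨isColimitOfReflects (IsDiscreteModule.{u, w} R).ι hc⟩, ⟨hc⟩⟩
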